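/- **Setting.** Let $(V,g)$ be a Euclidean vector space with $1\le\dim V<\infty$, and let $B\in\mathrm{End}(V)$ be $g$-symmetric and invertible. Let $W=V\oplus\mathbb R e_+\oplus\mathbb R e_-$ carry the Lorentzian metric that extends $g$, for which $e_\pm$ are null and orthogonal to $V$ and $\langle e_+,e_-\rangle=1$. The Lie algebra of the Cahen–Wallach space $M_B$ is $\mathfrak g=V^*\oplus W$ with $$[v^*,w]=-\langle Bv,w\rangle e_+,\qquad [v^*,e_-]=Bv,\qquad [e_-,w]=w^*\qquad(v,w\in V,\ v^*=\langle v,\cdot\rangle),$$ all other brackets being zero. Let $\mathrm{C\ell}(V)\subset\mathrm{C\ell}(W)$ be the complex Clifford algebras with $xy+yx=-2\langle x,y\rangle$, let $a\mapsto\bar a$ be the automorphism of $\mathrm{C\ell}(V)$ extending $v\mapsto-v$, and let $\Gamma_\pm\in\mathrm{C\ell}(W)$ be the images of $e_\pm$, $\sigma=\frac12[\Gamma_+,\Gamma_-]$, $\sigma_\pm=\frac12(1\pm\sigma)$. For $r\in\mathrm{C\ell}(\mathbb R^{1,1})$ and $a\in\mathrm{C\ell}(V)$ write $r\,\hat\otimes\,a\in\mathrm{C\ell}(W)$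 for the product of $r$ and $a$ in $\mathrm{C\ell}(W)$. For $a,b\in\mathrm{C\ell}(V)$ put $s_{a,b}(x)=ax-xb$ and $q_{a,b}(x)=a^2x+xb^2-2axb$. The pair $(a,b)$ is a *quadratic Clifford pair* if $q_{a,b}$ maps $V$ to $V$ and $q_{a,b}|_V$ is symmetric; it *represents* $T\in\mathrm{End}(V)$ if $q_{a,b}|_V=T$. Let $S$ be an irreducible $\mathrm{C\ell}(W)$-module. A *simple irreducible Clifford representation* of $M_B$ is a real linear map $\rho:\mathfrak g\to\mathrm{C\ell}(W)$ that, as a map to operators on $S$, (i) is on $V^*$ the spin representation of $V^*\subset\mathfrak{so}(W)$, where $v^*$ acts on $W$ as $Bv\wedge e_+:z\mapsto\langle e_+,z\rangle Bv-\langle Bv,z\rangle e_+$ and the spin representation sends $x\wedge y$ to $\frac14(yx-xy)$; (ii) is $V^*$-equivariant; (iii) is a representation of the Lie algebra $\mathfrak g$ on $S$. **Theorem.** (1) A linear map $\rho:\mathfrak g\to\mathrm{C\ell}(W)$ with $\rho(e_+)=0$ (on $S$) is a simple irreducible Clifford representation of $M_B$ if and only if there are $c,d,e\in\mathrm{C\ell}(V)$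 such that $(\bar c,d)$ is a quadratic Clifford pair representing $-B$ and, as operators on $S$, for all $v,w\in V$, $$\rho(v^*)=\tfrac12\Gamma_+\hat\otimes Bv,\qquad \rho(w)=-\tfrac12\Gamma_+\hat\otimes s_{\bar c,d}(w),\qquad \rho(e_-)=\sigma_-\hat\otimes c+\sigma_+\hat\otimes d+\Gamma_+\hat\otimes e .$$ (2) Conversely, for every $c,d\in\mathrm{C\ell}(V)$ for which $(\bar c,d)$ is a quadratic Clifford pair representing $-B$, and for every $e\in\mathrm{C\ell}(V)$ (so $e$ is a free parameter), these formulas and $\rho(e_+)=0$, read in $\mathrm{C\ell}(W)$, define a simple irreducible Clifford representation of $M_B$. (3) If $\dim V$ is even and $\rho$ is a simple irreducible Clifford representation with $\rho(e_+)=0$ in $\mathrm{C\ell}(W)$, then the formulas in (1) hold in $\mathrm{C\ell}(W)$ itself for a unique triple $(c,d,e)$ such that $(\bar c,d)$ is a quadratic Clifford pair representing $-B$. -/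

import Mathlib

open scoped TensorProduct InnerProductSpace

noncomputable section

namespace CW

/-! ### Complex Clifford algebras -/

section Clifford

variable {E : Type*} [AddCommGroup E] [Module ℝ E]

/-- The quadratic form `x ↦ -β(x, x)`. Its Clifford algebra has the relation
`x y + y x = -2 β(x, y)` when `β` is symmetric. -/
def cliffordForm (β : E →ₗ[ℝ] E →ₗ[ℝ] ℝ) : QuadraticForm ℝ E :=
  -LinearMap.BilinMap.toQuadraticMap β

/-- The complex Clifford algebra of the real space `(E, β)`. -/
abbrev Cl (β : E →ₗ[ℝ] E →ₗ[ℝ] ℝ) : Type _ := ℂ ⊗[ℝ] CliffordAlgebra (cliffordForm β)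

/-- The canonical real linear map `E → Cl(E)`. -/
def gam (β : E →ₗ[ℝ] E →ₗ[ℝ] ℝ) : E →ₗ[ℝ] Cl β :=
  (TensorProduct.mk ℝ ℂ (CliffordAlgebra (cliffordForm β)) 1).comp
    (CliffordAlgebra.ι (cliffordForm β))

/-- The grading automorphism `a ↦ ā` of `Cl(E)`: the complex linear automorphism that extends
`v ↦ -v`. -/
def bar (β : E →ₗ[ℝ] E →ₗ[ℝ] ℝ) : Cl β →ₐ[ℂ] Cl β :=
  Algebra.TensorProduct.map (AlgHom.id ℂ ℂ) CliffordAlgebra.involute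

/-- `s_{a,b}(x) = a x - x b`. -/
def sMap {R : Type*} [Ring R] (a b x : R) : R := a * x - x * b

/-- `q_{a,b}(x) = a² x + x b² - 2 a x b`. -/
def qMap {R : Type*} [Ring R] (a b x : R) : R := a ^ 2 * x + x * b ^ 2 - 2 * a * x * b

/-- The endomorphism `x ∧ y : z ↦ β(y, z) x - β(x, z) y`. -/
def wedge (β : E →ₗ[ℝ] E →ₗ[ℝ] ℝ) (x y z : E) : E := β y z • x - β x z • y

/-- The image `(y x - x y) / 4` of `x ∧ y ∈ so(E)` in `Cl(E)` under the spin representation. -/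
def spinWedge (β : E →ₗ[ℝ] E →ₗ[ℝ] ℝ) (x y : E) : Cl β :=
  (1 / 4 : ℂ) • (gam β y * gam β x - gam β x * gam β y)

theorem gam_anticomm (β : E →ₗ[ℝ] E →ₗ[ℝ] ℝ) (hβ : ∀ x y, β x y = β y x) (x y : E) :
    gam β x * gam β y + gam β y * gam β x = (-2 * β x y : ℝ) • (1 : Cl β) := by
  simp only [gam, LinearMap.comp_apply, TensorProduct.mk_apply,
    Algebra.TensorProduct.tmul_mul_tmul, ← TensorProduct.tmul_add,
    CliffordAlgebra.ι_mul_ι_add_swap, mul_one]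
  have h : QuadraticMap.polar (cliffordForm β) x y = -2 * β x y := by
    simp only [QuadraticMap.polar, cliffordForm, neg_apply,
      LinearMap.BilinMap.toQuadraticMap_apply, map_add, LinearMap.add_apply, hβ y x]
    ring
  rw [h, Algebra.algebraMap_eq_smul_one, TensorProduct.tmul_smul]
  rfl

end Clifford

/-! ### The Euclidean space `V` and the Lorentzian space `W = V ⊕ ℝ e₊ ⊕ ℝ e₋` -/

section Euclid

variable (V : Type*) [NormedAddCommGroup V] [InnerProductSpace ℝ V]

/-- The complex Clifford algebra `Cl(V)` of the Euclidean space `V`. -/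
abbrev ClV : Type _ := Cl (innerₗ V)

/-- `W = V ⊕ ℝ e₊ ⊕ ℝ e₋`; the triple `(w, p, m)` is `w + p e₊ + m e₋`. -/
abbrev W : Type _ := V × ℝ × ℝ

/-- The Lorentzian metric on `W`: it extends the one of `V`, the vectors `e₊`, `e₋` are null and
orthogonal to `V`, and `⟨e₊, e₋⟩ = 1`. -/
def lorentz : W V →ₗ[ℝ] W V →ₗ[ℝ] ℝ :=
  LinearMap.mk₂ ℝ (fun x y => ⟪x.1, y.1⟫_ℝ + x.2.1 * y.2.2 + x.2.2 * y.2.1)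
    (fun x x' y => by simp [inner_add_left]; ring)
    (fun c x y => by simp [real_inner_smul_left]; ring)
    (fun x y y' => by simp [inner_add_right]; ring)
    (fun c x y => by simp [real_inner_smul_right]; ring)

/-- The complex Clifford algebra `Cl(W)`. -/
abbrev ClW : Type _ := Cl (lorentz V)

/-- The isometric inclusion `V → W`. -/
def inclV : cliffordForm (innerₗ V) →qᵢ cliffordForm (lorentz V) where
  toLinearMap := LinearMap.inl ℝ V (ℝ × ℝ)
  map_app' := fun v => by simp [cliffordForm, lorentz]

/-- The inclusion `a ↦ 1 ⊗̂ a` of `Cl(V)` in `Cl(W) = Cl(ℝ^{1,1}) ⊗̂ Cl(V)`, induced by `V ⊂ W`.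
With `r ∈ Cl(ℝ^{1,1}) ⊂ Cl(W)`, the element `r ⊗̂ a` is the product `r * incl V a` in `Cl(W)`. -/
def incl : ClV V →ₐ[ℂ] ClW V :=
  Algebra.TensorProduct.map (AlgHom.id ℂ ℂ) (CliffordAlgebra.map (inclV V))

/-- `e₊` -/
def ePlus : W V := (0, 1, 0)

/-- `e₋` -/
def eMinus : W V := (0, 0, 1)

/-- `Γ₊` -/
def GammaP : ClW V := gam (lorentz V) (ePlus V)

/-- `Γ₋` -/
def GammaM : ClW V := gam (lorentz V) (eMinus V)

/-- `σ = [Γ₊, Γ₋] / 2` -/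
def sigma : ClW V := (1 / 2 : ℂ) • (GammaP V * GammaM V - GammaM V * GammaP V)

/-- `σ₊ = (1 + σ) / 2` -/
def sigmaP : ClW V := (1 / 2 : ℂ) • (1 + sigma V)

/-- `σ₋ = (1 - σ) / 2` -/
def sigmaM : ClW V := (1 / 2 : ℂ) • (1 - sigma V)

variable {V}

/-- A pair `(a, b)` is a quadratic Clifford pair if `q_{a,b}` maps `V ⊂ Cl(V)` to `V` and its
restriction to `V` is a symmetric endomorphism of `V`. -/
def IsQuadraticCliffordPair (a b : ClV V) : Prop :=
  ∃ T : V →ₗ[ℝ] V, T.IsSymmetric ∧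
    ∀ v : V, qMap a b (gam (innerₗ V) v) = gam (innerₗ V) (T v)

/-- A quadratic Clifford pair `(a, b)` is associated to (represents) `T ∈ End(V)` if
`q_{a,b}` restricted to `V` equals `T`. -/
def IsAssociatedTo (a b : ClV V) (T : V →ₗ[ℝ] V) : Prop :=
  IsQuadraticCliffordPair a b ∧ ∀ v : V, qMap a b (gam (innerₗ V) v) = gam (innerₗ V) (T v)

end Euclid

/-! ### The Lie algebra of a Cahen–Wallach space -/

/-- The datum that defines a Cahen–Wallach space `M_B`: a symmetric endomorphism `B` of the
Euclidean space `V`. -/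
structure Datum (V : Type*) [NormedAddCommGroup V] [InnerProductSpace ℝ V] where
  /-- the symmetric endomorphism -/
  B : V →ₗ[ℝ] V
  symm : B.IsSymmetric

namespace Datum

variable {V : Type*} [NormedAddCommGroup V] [InnerProductSpace ℝ V] (M : Datum V)

/-- The Lie algebra `𝔤 = V* ⊕ W`; the pair `(v, x)` is `v* + x` with `v* = ⟨v, ·⟩`. -/
def Alg (_M : Datum V) : Type _ := V × W V

instance : AddCommGroup M.Alg := inferInstanceAs (AddCommGroup (V × W V))

instance : Module ℝ M.Alg := inferInstanceAs (Module ℝ (V × W V))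

/-- The element `v* + x` of `𝔤`. -/
def elt (v : V) (x : W V) : M.Alg := (v, x)

/-- The `V*`-component, as a vector of `V`. -/
def fstL : M.Alg →ₗ[ℝ] V := LinearMap.fst ℝ V (W V)

/-- The `W`-component. -/
def sndL : M.Alg →ₗ[ℝ] W V := LinearMap.snd ℝ V (W V)

/-- `v*` as an element of `𝔤` -/
def star (v : V) : M.Alg := M.elt v 0

/-- An element of `W` as an element of `𝔤` -/
def ofW (x : W V) : M.Alg := M.elt 0 x

/-- An element of `V ⊂ W` as an element of `𝔤` -/
def ofV (w : V) : M.Alg := M.ofW (w, 0, 0)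

/-- `e₊` as an element of `𝔤` -/
def eP : M.Alg := M.ofW (ePlus V)

/-- `e₋` as an element of `𝔤` -/
def eM : M.Alg := M.ofW (eMinus V)

@[simp] theorem fstL_elt (v : V) (x : W V) : M.fstL (M.elt v x) = v := rfl

@[simp] theorem sndL_elt (v : V) (x : W V) : M.sndL (M.elt v x) = x := rfl

theorem alg_ext {x y : M.Alg} (h₁ : M.fstL x = M.fstL y) (h₂ : M.sndL x = M.sndL y) : x = y :=
  Prod.ext h₁ h₂

/-- The bracket of `𝔤`, the bilinear alternating extension of `[v*, w] = -⟨B v, w⟩ e₊`,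
`[v*, e₋] = B v`, `[e₋, w] = w*`, with all other brackets zero. -/
instance : Bracket M.Alg M.Alg where
  bracket x y :=
    M.elt ((M.sndL x).2.2 • (M.sndL y).1 - (M.sndL y).2.2 • (M.sndL x).1)
      ((M.sndL y).2.2 • M.B (M.fstL x) - (M.sndL x).2.2 • M.B (M.fstL y),
        ⟪M.B (M.fstL y), (M.sndL x).1⟫_ℝ - ⟪M.B (M.fstL x), (M.sndL y).1⟫_ℝ, 0)

theorem bracket_eq (x y : M.Alg) : ⁅x, y⁆ =
    M.elt ((M.sndL x).2.2 • (M.sndL y).1 - (M.sndL y).2.2 • (M.sndL x).1)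
      ((M.sndL y).2.2 • M.B (M.fstL x) - (M.sndL x).2.2 • M.B (M.fstL y),
        ⟪M.B (M.fstL y), (M.sndL x).1⟫_ℝ - ⟪M.B (M.fstL x), (M.sndL y).1⟫_ℝ, 0) := rfl

instance : LieRing M.Alg where
  add_lie x y z := by
    apply M.alg_ext
    · simp only [bracket_eq, map_add, fstL_elt, Prod.fst_add, Prod.snd_add]
      module
    · ext
      · simp only [bracket_eq, map_add, sndL_elt, Prod.fst_add, Prod.snd_add]
        module
      · simp only [bracket_eq, map_add, sndL_elt, Prod.fst_add, Prod.snd_add, inner_add_left,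
          inner_add_right]
        ring
      · simp [bracket_eq]
  lie_add x y z := by
    apply M.alg_ext
    · simp only [bracket_eq, map_add, fstL_elt, Prod.fst_add, Prod.snd_add]
      module
    · ext
      · simp only [bracket_eq, map_add, sndL_elt, Prod.fst_add, Prod.snd_add]
        module
      · simp only [bracket_eq, map_add, sndL_elt, Prod.fst_add, Prod.snd_add, inner_add_left,
          inner_add_right]
        ring
      · simp [bracket_eq]
  lie_self x := by
    apply M.alg_ext
    · simp [bracket_eq]
    · ext <;> simp [bracket_eq]
  leibniz_lie x y z := by
    have h : ∀ u v : V, ⟪M.B u, v⟫_ℝ = ⟪M.B v, u⟫_ℝ := fun u v => by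
      rw [M.symm u v, real_inner_comm]
    apply M.alg_ext
    · simp only [bracket_eq, map_add, fstL_elt, sndL_elt]
      module
    · ext
      · simp only [bracket_eq, map_add, map_sub, map_smul, fstL_elt, sndL_elt, Prod.fst_add]
        module
      · simp only [bracket_eq, map_add, map_sub, map_smul, fstL_elt, sndL_elt, Prod.fst_add,
          Prod.snd_add, inner_sub_left, inner_sub_right, real_inner_smul_left,
          real_inner_smul_right]
        rw [h (M.sndL z).1 (M.sndL x).1, h (M.sndL y).1 (M.sndL x).1,
          h (M.sndL z).1 (M.sndL y).1, real_inner_comm (M.B (M.fstL x)) (M.B (M.fstL y)),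
          real_inner_comm (M.B (M.fstL x)) (M.B (M.fstL z)),
          real_inner_comm (M.B (M.fstL y)) (M.B (M.fstL z))]
        ring
      · simp [bracket_eq]

instance : LieAlgebra ℝ M.Alg where
  lie_smul t x y := by
    apply M.alg_ext
    · simp only [bracket_eq, map_smul, fstL_elt, Prod.smul_fst, Prod.smul_snd, smul_eq_mul]
      module
    · ext
      · simp only [bracket_eq, map_smul, sndL_elt, Prod.smul_fst, Prod.smul_snd, smul_eq_mul]
        module
      · simp only [bracket_eq, map_smul, sndL_elt, Prod.smul_fst, Prod.smul_snd, smul_eq_mul,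
          real_inner_smul_left, real_inner_smul_right]
        ring
      · simp [bracket_eq]

/-- The spin representation of `V* ⊂ so(W)`, where `v* ∈ V*` acts on `W` as `B v ∧ e₊`. -/
def spin (v : V) : ClW V := spinWedge (lorentz V) (M.B v, 0, 0) (ePlus V)

/-- The isotropy action of `V*` on `W` is `v* ↦ B v ∧ e₊`. -/
theorem star_lie_ofW (v : V) (x : W V) :
    ⁅M.star v, M.ofW x⁆ = M.ofW (wedge (lorentz V) (M.B v, 0, 0) (ePlus V) x) := by
  apply M.alg_ext
  · simp [bracket_eq, star, ofW]
  · ext <;> simp [bracket_eq, star, ofW, wedge, lorentz, ePlus]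

/-! ### Clifford maps and Clifford representations -/

/-- `a` and `b` act on the Clifford module `S` by the same operator. -/
def _root_.CW.SameAction (S : Type*) [AddCommGroup S] [Module (ClW V) S] (a b : ClW V) : Prop :=
  ∀ s : S, a • s = b • s

/-- A simple Clifford map of `M_B` acting on the Clifford module `S`: a linear map
`ρ : 𝔤 → Cl(W)` that, as a map to operators on `S`, is the spin representation on `V*` and is
`V*`-equivariant. -/
structure IsCliffordMap (S : Type*) [AddCommGroup S] [Module (ClW V) S]
    (ρ : M.Alg →ₗ[ℝ] ClW V) : Prop where
  spin_rep : ∀ v : V, SameAction S (ρ (M.star v)) (M.spin v)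
  equivariant : ∀ (v : V) (x : M.Alg),
    SameAction S (ρ ⁅M.star v, x⁆) (M.spin v * ρ x - ρ x * M.spin v)

/-- A simple Clifford representation of `M_B` on the Clifford module `S`: a Clifford map that is a
representation of the Lie algebra `𝔤` on `S`. -/
structure IsCliffordRep (S : Type*) [AddCommGroup S] [Module (ClW V) S]
    (ρ : M.Alg →ₗ[ℝ] ClW V) : Prop extends M.IsCliffordMap S ρ where
  map_lie : ∀ x y : M.Alg, SameAction S (ρ ⁅x, y⁆) (ρ x * ρ y - ρ y * ρ x)

end Datum

end CW

end

/-! Write `P`, `N` for the actions of `Γ₊`, `Γ₋`. Every element of `Cl(W)` has the form `σ₋ c + σ₊ d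
+ P e + N f` with `c, d, e, f` in `Cl(V)` (`exists_lightForm`); apply this to `ρ(e₋)`. The bracket
`[v*, Bv]` is a multiple of `e₊`, which acts by zero, so `ρ(v*)` commutes with `ρ(Bv) = [ρ(v*),
ρ(e₋)]`; for `Bv` a unit vector this forces `N f = 0` (`right_eq_zero_of_lie`). Since `B` is onto,
`[v*, e₋] = Bv` then gives the formula on `V` (`lie_lightForm`), and `[e₋, w] = w*` together with `q
= s ∘ s` gives `P (q(w) + Bw) = 0`.

It remains to cancel `P` (`exists_reduction`). The elements `a` with `P a = 0` form a proper
two-sided ideal of `Cl(V)`. In even dimension `Cl(V)` is simple, so the ideal is zero. In odd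
dimension `Cl(V)` is only graded simple, but the central volume element of `Cl(W)` acts on `S` by a
sign, which lets `c` and `d` be replaced by even elements with the same action; `q(w) + Bw` is then
odd, and an odd element of the ideal vanishes.

Conversely, on `V* ⊕ V` the formulas are null translations `P α`, which multiply to zero, so only
brackets with `e₋` matter, and these reduce to `q = s ∘ s` (`nullPart_lie`). Irreducibility enters
only through `S ≠ 0` and the sign of central involutions. -/

noncomputable section

namespace CW

/-! ### Graded simplicity and volume elements of Clifford algebras -/

section Generators

variable {A ι : Type*} [Ring A] [Algebra ℂ A]

/-- Anticommuting generators `e i` with square `-1` of an algebra with a grading involution `τ`. -/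
structure IsCliffordSystem (e : ι → A) (τ : A →ₐ[ℂ] A) : Prop where
  sq : ∀ i, e i * e i = -1
  anticomm : ∀ i j, i ≠ j → e i * e j = -(e j * e i)
  odd : ∀ i, τ (e i) = -e i
  invol : ∀ a, τ (τ a) = a
  adjoin : Algebra.adjoin ℂ (Set.range e) = ⊤

namespace IsCliffordSystem

variable {e : ι → A} {τ : A →ₐ[ℂ] A} (h : IsCliffordSystem e τ)
include h

theorem mul_eq_of_mem_adjoin {i : ι} {T : Set ι} (hi : i ∉ T) {a : A}
    (ha : a ∈ Algebra.adjoin ℂ (e '' T)) : e i * a = τ a * e i := by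
  induction ha using Algebra.adjoin_induction with
  | mem x hx =>
    obtain ⟨j, hj, rfl⟩ := hx
    rw [h.anticomm i j (fun hij => hi (hij ▸ hj)), h.odd, neg_mul]
  | algebraMap r => rw [AlgHom.commutes, Algebra.commutes]
  | add x y _ _ hx hy => rw [mul_add, hx, hy, map_add, add_mul]
  | mul x y _ _ hx hy => rw [← mul_assoc, hx, mul_assoc, hy, map_mul, mul_assoc]

theorem map_mem_adjoin {T : Set ι} {a : A} (ha : a ∈ Algebra.adjoin ℂ (e '' T)) :
    τ a ∈ Algebra.adjoin ℂ (e '' T) := by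
  induction ha using Algebra.adjoin_induction with
  | mem x hx =>
    obtain ⟨j, hj, rfl⟩ := hx
    rw [h.odd]
    exact neg_mem (Algebra.subset_adjoin ⟨j, hj, rfl⟩)
  | algebraMap r => rw [AlgHom.commutes]; exact Subalgebra.algebraMap_mem _ r
  | add x y _ _ hx hy => rw [map_add]; exact add_mem hx hy
  | mul x y _ _ hx hy => rw [map_mul]; exact mul_mem hx hy

/-- As `e i` squares to `-1` and passes the smaller subalgebra at the cost of `τ`, the elements `a +
e i * b` are closed under products. -/
theorem exists_of_mem_adjoin_insert {i : ι} {T : Set ι} (hi : i ∉ T) {x : A}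
    (hx : x ∈ Algebra.adjoin ℂ (e '' insert i T)) :
    ∃ a ∈ Algebra.adjoin ℂ (e '' T), ∃ b ∈ Algebra.adjoin ℂ (e '' T), x = a + e i * b := by
  have hcomm : ∀ a ∈ Algebra.adjoin ℂ (e '' T), a * e i = e i * τ a := fun a ha => by
    rw [h.mul_eq_of_mem_adjoin hi (h.map_mem_adjoin ha), h.invol]
  induction hx using Algebra.adjoin_induction with
  | mem x hx =>
    obtain ⟨j, hj, rfl⟩ := hx
    rcases hj with rfl | hj
    · exact ⟨0, zero_mem _, 1, one_mem _, by simp⟩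
    · exact ⟨e j, Algebra.subset_adjoin ⟨j, hj, rfl⟩, 0, zero_mem _, by simp⟩
  | algebraMap r => exact ⟨_, Subalgebra.algebraMap_mem _ r, 0, zero_mem _, by simp⟩
  | add x y _ _ hx hy =>
    obtain ⟨a, ha, b, hb, rfl⟩ := hx
    obtain ⟨a', ha', b', hb', rfl⟩ := hy
    exact ⟨a + a', add_mem ha ha', b + b', add_mem hb hb', by rw [mul_add]; abel⟩
  | mul x y _ _ hx hy =>
    obtain ⟨a, ha, b, hb, rfl⟩ := hx
    obtain ⟨a', ha', b', hb', rfl⟩ := hy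
    refine ⟨a * a' - τ b * b', sub_mem (mul_mem ha ha') (mul_mem (h.map_mem_adjoin hb) hb'),
      τ a * b' + b * a', add_mem (mul_mem (h.map_mem_adjoin ha) hb') (mul_mem hb ha'), ?_⟩
    have h₁ : a * (e i * b') = e i * (τ a * b') := by
      rw [← mul_assoc, hcomm a ha, mul_assoc]
    have h₂ : e i * b * (e i * b') = -(τ b * b') := by
      rw [mul_assoc, ← mul_assoc b, hcomm b hb, mul_assoc, ← mul_assoc, h.sq, neg_one_mul]
    rw [add_mul, mul_add, mul_add, h₁, h₂, mul_add, mul_assoc]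
    abel

theorem eq_zero_of_mem_adjoin (J : Ideal A) (hr : ∀ x ∈ J, ∀ y, x * y ∈ J)
    (hτ : ∀ x ∈ J, τ x ∈ J) (h1 : (1 : A) ∉ J) (T : Finset ι) :
    ∀ x ∈ J, x ∈ Algebra.adjoin ℂ (e '' T) → x = 0 := by
  classical
  induction T using Finset.induction_on with
  | empty =>
    intro x hx hxT
    rw [Finset.coe_empty, Set.image_empty, Algebra.adjoin_empty, Algebra.mem_bot] at hxT
    obtain ⟨r, rfl⟩ := hxT
    by_contra hr0
    have hr' : r ≠ 0 := fun h0 => hr0 (by rw [h0, map_zero])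
    apply h1
    have := J.mul_mem_left (algebraMap ℂ A r⁻¹) hx
    rwa [← map_mul, inv_mul_cancel₀ hr', map_one] at this
  | insert i T hi ih =>
    intro x hx hxT
    rw [Finset.coe_insert] at hxT
    have hi' : i ∉ (T : Set ι) := by simpa using hi
    obtain ⟨a, ha, b, hb, rfl⟩ := h.exists_of_mem_adjoin_insert hi' hxT
    have ha0 : a = 0 := by
      apply ih a _ ha
      have h₁ : e i * (a + e i * b) * e i = -τ a - e i * τ b := by
        rw [mul_add, add_mul, h.mul_eq_of_mem_adjoin hi' ha, mul_assoc (τ a), h.sq, mul_neg_one,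
          ← mul_assoc, h.sq, neg_one_mul, h.mul_eq_of_mem_adjoin hi' (h.map_mem_adjoin hb),
          h.invol, neg_mul, sub_eq_add_neg]
      -- The operation `x ↦ τ x - e i * x * e i` preserves `J`, kills the part `e i * b` and doubles
      -- `τ a`.
      have h₂ : τ (a + e i * b) - e i * (a + e i * b) * e i ∈ J :=
        sub_mem (hτ _ hx) (hr _ (J.mul_mem_left _ hx) _)
      have h₃ : τ (a + e i * b) - e i * (a + e i * b) * e i = algebraMap ℂ A 2 * τ a := by
        rw [h₁, map_add, map_mul, h.odd, neg_mul, map_ofNat, two_mul]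
        abel
      rw [h₃] at h₂
      have h₄ := hτ _ (J.mul_mem_left (algebraMap ℂ A 2⁻¹) h₂)
      rwa [← mul_assoc, ← map_mul, inv_mul_cancel₀ two_ne_zero, map_one, one_mul, h.invol] at h₄
    subst ha0
    have hb0 : b = 0 := by
      apply ih b _ hb
      have := J.mul_mem_left (e i) hx
      rw [zero_add, ← mul_assoc, h.sq, neg_one_mul] at this
      simpa using neg_mem this
    rw [hb0, mul_zero, add_zero]

/-- A Clifford system generates a graded simple algebra. -/
theorem eq_zero_of_mem [Fintype ι] (J : Ideal A) (hr : ∀ x ∈ J, ∀ y, x * y ∈ J)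
    (hτ : ∀ x ∈ J, τ x ∈ J) (h1 : (1 : A) ∉ J) {x : A} (hx : x ∈ J) : x = 0 := by
  refine h.eq_zero_of_mem_adjoin J hr hτ h1 Finset.univ x hx ?_
  rw [Finset.coe_univ, Set.image_univ, h.adjoin]
  exact Algebra.mem_top

theorem prod_mul_of_notMem {l : List ι} {i : ι} (hi : i ∉ l) :
    (l.map e).prod * e i = (-1 : ℂ) ^ l.length • (e i * (l.map e).prod) := by
  induction l with
  | nil => simp
  | cons j l ih =>
    rw [List.mem_cons, not_or] at hi
    rw [List.map_cons, List.prod_cons, mul_assoc, ih hi.2, mul_smul_comm, ← mul_assoc,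
      h.anticomm j i (Ne.symm hi.1), List.length_cons, pow_succ, neg_mul, mul_assoc]
    simp

/-- Passing `e i` changes sign at every factor except `e i` itself: `length - 1` signs, of the same
parity as `length + 1`. -/
theorem prod_mul_of_mem {l : List ι} (hl : l.Nodup) {i : ι} (hi : i ∈ l) :
    (l.map e).prod * e i = (-1 : ℂ) ^ (l.length + 1) • (e i * (l.map e).prod) := by
  induction l with
  | nil => simp at hi
  | cons j l ih =>
    rw [List.nodup_cons] at hl
    rw [List.map_cons, List.prod_cons, mul_assoc, List.length_cons]
    by_cases hij : i = j
    · subst hij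
      rw [h.prod_mul_of_notMem hl.1, mul_smul_comm, pow_succ, pow_succ]
      simp
    · have hi' : i ∈ l := by simpa [hij] using hi
      rw [ih hl.2 hi', mul_smul_comm, ← mul_assoc, h.anticomm j i (Ne.symm hij), pow_succ _ (_ + 1),
        neg_mul, mul_assoc]
      simp

theorem map_prod (l : List ι) : τ (l.map e).prod = (-1 : ℂ) ^ l.length • (l.map e).prod := by
  induction l with
  | nil => simp
  | cons j l ih =>
    rw [List.map_cons, List.prod_cons, map_mul, ih, h.odd, List.length_cons, pow_succ]
    simp

theorem exists_prod_mul_prod {l : List ι} (hl : l.Nodup) :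
    ∃ z : ℂ, z ≠ 0 ∧ (l.map e).prod * (l.map e).prod = z • 1 := by
  induction l with
  | nil => exact ⟨1, one_ne_zero, by simp⟩
  | cons j l ih =>
    rw [List.nodup_cons] at hl
    obtain ⟨z, hz, hzl⟩ := ih hl.2
    refine ⟨(-1) ^ l.length * -z, by simpa using hz, ?_⟩
    rw [List.map_cons, List.prod_cons, mul_assoc, ← mul_assoc (l.map e).prod,
      h.prod_mul_of_notMem hl.1, smul_mul_assoc, mul_smul_comm, mul_assoc (e j) (l.map e).prod, hzl,
      ← mul_assoc, h.sq, neg_one_mul, mul_smul]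
    simp

/-- The normalized volume element. -/
theorem exists_volume [Fintype ι] : ∃ w : A, w * w = 1 ∧
    τ w = (-1 : ℂ) ^ Fintype.card ι • w ∧
    ∀ i, w * e i = (-1 : ℂ) ^ (Fintype.card ι + 1) • (e i * w) := by
  obtain ⟨z, hz, hzl⟩ := h.exists_prod_mul_prod (Finset.univ : Finset ι).nodup_toList
  -- The product of all generators squares to a scalar `z ≠ 0`; a square root of `z⁻¹` normalizes
  -- it.
  obtain ⟨y, hy⟩ := IsAlgClosed.exists_pow_nat_eq z⁻¹ (n := 2) (by norm_num)
  have hlen : (Finset.univ : Finset ι).toList.length = Fintype.card ι := by simp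
  refine ⟨y • ((Finset.univ : Finset ι).toList.map e).prod, ?_, ?_, fun i => ?_⟩
  · rw [smul_mul_smul_comm, hzl, smul_smul, ← pow_two, hy, inv_mul_cancel₀ hz, one_smul]
  · rw [map_smul, h.map_prod, hlen, smul_comm]
  · rw [smul_mul_assoc, h.prod_mul_of_mem (Finset.nodup_toList _) (by simp), hlen, smul_comm,
      mul_smul_comm]

theorem induction_adjoin {p : A → Prop} (hmem : ∀ i, p (e i))
    (hmap : ∀ r : ℂ, p (algebraMap ℂ A r)) (hadd : ∀ x y, p x → p y → p (x + y))
    (hmul : ∀ x y, p x → p y → p (x * y)) (a : A) : p a := by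
  have ha : a ∈ Algebra.adjoin ℂ (Set.range e) := h.adjoin ▸ Algebra.mem_top
  induction ha using Algebra.adjoin_induction with
  | mem x hx => obtain ⟨i, rfl⟩ := hx; exact hmem i
  | algebraMap r => exact hmap r
  | add x y _ _ hx hy => exact hadd x y hx hy
  | mul x y _ _ hx hy => exact hmul x y hx hy

theorem exists_volume_of_even [Fintype ι] (hn : Even (Fintype.card ι)) :
    ∃ w : A, w * w = 1 ∧ ∀ a, w * a = τ a * w := by
  obtain ⟨w, hw, -, hwe⟩ := h.exists_volume
  refine ⟨w, hw, h.induction_adjoin (fun i => ?_) (fun r => ?_) (fun x y hx hy => ?_)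
    fun x y hx hy => ?_⟩
  · rw [hwe, hn.add_one.neg_one_pow, h.odd, neg_one_smul, neg_mul]
  · rw [AlgHom.commutes, Algebra.commutes]
  · rw [mul_add, hx, hy, map_add, add_mul]
  · rw [← mul_assoc, hx, mul_assoc, hy, map_mul, mul_assoc]

theorem exists_volume_of_odd [Fintype ι] (hn : Odd (Fintype.card ι)) :
    ∃ w : A, w * w = 1 ∧ τ w = -w ∧ ∀ a, w * a = a * w := by
  obtain ⟨w, hw, hτw, hwe⟩ := h.exists_volume
  refine ⟨w, hw, by rw [hτw, hn.neg_one_pow, neg_one_smul], h.induction_adjoin (fun i => ?_)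
    (fun r => ?_) (fun x y hx hy => ?_) fun x y hx hy => ?_⟩
  · rw [hwe, hn.add_one.neg_one_pow, one_smul]
  · rw [Algebra.commutes]
  · rw [mul_add, hx, hy, add_mul]
  · rw [← mul_assoc, hx, mul_assoc, hy, mul_assoc]

/-- A Clifford system with an even number of generators generates a simple algebra. -/
theorem eq_zero_of_mem_of_even [Fintype ι] (hn : Even (Fintype.card ι)) (J : Ideal A)
    (hr : ∀ x ∈ J, ∀ y, x * y ∈ J) (h1 : (1 : A) ∉ J) {x : A} (hx : x ∈ J) : x = 0 := by
  obtain ⟨w, hw, hwa⟩ := h.exists_volume_of_even hn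
  -- Conjugation by `w` is `τ`, so every two-sided ideal is `τ`-stable.
  refine h.eq_zero_of_mem J hr (fun y hy => ?_) h1 hx
  have := hr _ (J.mul_mem_left w hy) w
  rwa [hwa, mul_assoc, hw, mul_one] at this

/-- An element of definite parity in a proper ideal vanishes. -/
theorem eq_zero_of_mem_of_map_mem [Fintype ι] (J : Ideal A) (hr : ∀ x ∈ J, ∀ y, x * y ∈ J)
    (h1 : (1 : A) ∉ J) {x : A} (hx : x ∈ J) (hτx : τ x ∈ J) : x = 0 := by
  -- The ideal `J ∩ τ⁻¹ J` is `τ`-stable, so graded simplicity applies to it.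
  refine h.eq_zero_of_mem (J ⊓ J.comap τ) (fun x hx y => ⟨hr x hx.1 y, ?_⟩)
    (fun x hx => ⟨hx.2, ?_⟩) (fun h' => h1 h'.1) (x := x) ⟨hx, hτx⟩
  · rw [SetLike.mem_coe, Ideal.mem_comap, map_mul]
    exact hr _ hx.2 _
  · rw [SetLike.mem_coe, Ideal.mem_comap, h.invol]
    exact hx.1

end IsCliffordSystem
end Generators
end CW

namespace CW

/-! ### Identities for `s` and `q` -/

section Ring

variable {R : Type*} [Ring R]

theorem map_qMap_add [Algebra ℂ R] {τ : R →ₐ[ℂ] R} {a b x y : R} (ha : τ a = a)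
    (hb : τ b = b) (hx : τ x = -x)
    (hy : τ y = -y) : τ (qMap a b x + y) = -(qMap a b x + y) := by
  simp only [qMap, map_add, map_sub, map_mul, map_pow, map_ofNat, ha, hb, hx, hy]
  noncomm_ring

theorem sMap_lie {a b x y z : R} (h : qMap a b y = -z) :
    (x - sMap a b y) * b - a * (x - sMap a b y) = -sMap a b x - z := by
  rw [← neg_eq_iff_eq_neg.mpr h]
  simp only [sMap, qMap]
  noncomm_ring

/-- This is `q = s ∘ s`. -/
theorem lie_sMap (a b x : R) : a * sMap a b x - sMap a b x * b = qMap a b x := by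
  simp only [sMap, qMap]
  noncomm_ring

theorem sub_sMap_smul [Algebra ℂ R] (a b x y z w : R) (m n : ℂ) :
    m • z - n • w - sMap a b (n • x - m • y) =
      n • (-sMap a b x - w) - m • (-sMap a b y - z) := by
  simp only [sMap, mul_sub, sub_mul, mul_smul_comm, smul_mul_assoc]
  module

end Ring

/-! ### Calculus with two null elements -/

section LightCone

variable {A Q : Type*} [Ring A] [Algebra ℂ A] [Ring Q] [Algebra ℂ Q]

/-- Two null elements `P`, `N` with `P N + N P = -2` that supercommute with the image of a graded
algebra. -/
structure IsLightCone (τ : A →ₐ[ℂ] A) (j : A →ₐ[ℂ] Q) (P N : Q) : Prop where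
  invol : ∀ a, τ (τ a) = a
  null_left : P * P = 0
  null_right : N * N = 0
  swap : N * P = -2 - P * N
  comm_left : ∀ a, j a * P = P * j (τ a)
  comm_right : ∀ a, j a * N = N * j (τ a)

/-- The element `σ₋ c + σ₊ d + P e + N f`, with `σ₋ = -P N / 2` and `σ₊ = -N P / 2`. -/
def lightForm (j : A →ₐ[ℂ] Q) (P N : Q) (c d e f : A) : Q :=
  (-(1 / 2 : ℂ)) • (P * N) * j c + (-(1 / 2 : ℂ)) • (N * P) * j d + P * j e + N * j f

namespace IsLightCone

variable {τ : A →ₐ[ℂ] A} {j : A →ₐ[ℂ] Q} {P N : Q} (h : IsLightCone τ j P N)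
include h

theorem null_left' (x : Q) : P * (P * x) = 0 := by rw [← mul_assoc, h.null_left, zero_mul]

theorem null_right' (x : Q) : N * (N * x) = 0 := by rw [← mul_assoc, h.null_right, zero_mul]

theorem swap' (x : Q) : N * (P * x) = (-2 : ℂ) • x - P * (N * x) := by
  rw [← mul_assoc, h.swap, sub_mul, mul_assoc, neg_mul, neg_smul, two_mul, two_smul]

theorem comm_left' (a : A) (x : Q) : j a * (P * x) = P * (j (τ a) * x) := by
  rw [← mul_assoc, h.comm_left, mul_assoc]

theorem comm_right' (a : A) (x : Q) : j a * (N * x) = N * (j (τ a) * x) := by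
  rw [← mul_assoc, h.comm_right, mul_assoc]

theorem swap_smul : N * P = (-2 : ℂ) • 1 - P * N := by
  have := h.swap' 1
  rwa [mul_one, mul_one] at this

/-- The commutator of the null translation `P α` with a general element. -/
theorem lie_lightForm (α c d e : A) :
    P * j α * lightForm j P N c d e 0 - lightForm j P N c d e 0 * (P * j α)
      = P * j (α * d - τ c * α) := by
  simp only [lightForm, map_zero, mul_zero, add_zero, map_sub, map_mul, mul_add, add_mul, mul_sub,
    sub_mul, mul_assoc, smul_mul_assoc, mul_smul_comm, h.null_left', h.swap', h.comm_left',
    h.comm_right', h.invol, mul_zero, smul_zero]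
  module

theorem lie_left_left (α β : A) : P * j α * (P * j β) = 0 := by
  rw [mul_assoc, h.comm_left', h.null_left']

theorem left_mul_right_mul_left' (x : Q) : P * (N * (P * x)) = (-2 : ℂ) • (P * x) := by
  rw [h.swap', mul_sub, h.null_left', sub_zero, mul_smul_comm]

theorem right_mul_left_mul_right' (x : Q) : N * (P * (N * x)) = (-2 : ℂ) • (N * x) := by
  rw [h.swap', h.null_right', mul_zero, sub_zero]

theorem map {R : Type*} [Ring R] [Algebra ℂ R] (φ : Q →ₐ[ℂ] R) :
    IsLightCone τ (φ.comp j) (φ P) (φ N) where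
  invol := h.invol
  null_left := by rw [← map_mul, h.null_left, map_zero]
  null_right := by rw [← map_mul, h.null_right, map_zero]
  swap := by rw [← map_mul, h.swap, map_sub, map_neg, map_ofNat, map_mul]
  comm_left a := by simp only [AlgHom.comp_apply, ← map_mul, h.comm_left]
  comm_right a := by simp only [AlgHom.comp_apply, ← map_mul, h.comm_right]

/-- Under `(c, d, e, f) ↦ !![τ c, e; -2 τ f, d]` this is the product of 2 × 2 matrices over `A`. -/
theorem lightForm_mul (c d e f c' d' e' f' : A) :
    lightForm j P N c d e f * lightForm j P N c' d' e' f' =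
      lightForm j P N (c * c' - (2 : ℂ) • (τ e * f')) (d * d' - (2 : ℂ) • (τ f * e'))
        (τ c * e' + e * d') (τ d * f' + f * c') := by
  simp only [lightForm, map_add, map_sub, map_smul, map_mul, mul_add, add_mul, mul_sub, sub_mul,
    mul_assoc, smul_mul_assoc, mul_smul_comm, h.null_left', h.null_right', h.swap', h.comm_left',
    h.comm_right', h.invol, mul_zero, smul_zero]
  module

theorem lightForm_algebraMap (r : ℂ) :
    lightForm j P N (algebraMap ℂ A r) (algebraMap ℂ A r) 0 0 = algebraMap ℂ Q r := by
  simp only [lightForm, Algebra.algebraMap_eq_smul_one, map_smul, map_one, map_zero, mul_zero,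
    add_zero, h.swap_smul, mul_smul_comm, mul_one]
  module

theorem right_eq_zero {f : A} (hf : P * j (τ f) = 0) : N * j f = 0 := by
  have h₁ : N * (P * j (τ f) * N) = (-2 : ℂ) • (N * j f) := by
    rw [mul_assoc, h.comm_right, h.invol, h.right_mul_left_mul_right']
  rw [hf, zero_mul, mul_zero] at h₁
  exact (smul_eq_zero.mp h₁.symm).resolve_left (by norm_num)

/-- If the value of `β` on the null translations commutes with `P β`, the `N`-part vanishes. -/
theorem right_eq_zero_of_lie {β f γ : A} (hβ : β * β = -1) (hτ : τ β = -β)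
    (hl : P * j β * (P * j γ + (P * j β * (N * j f) - N * j f * (P * j β))) =
      (P * j γ + (P * j β * (N * j f) - N * j f * (P * j β))) * (P * j β)) :
    N * j f = 0 := by
  apply h.right_eq_zero
  have hβ' : j β * j β = -1 := by rw [← map_mul, hβ, map_neg, map_one]
  have hβ'' : ∀ x, j β * (j β * x) = -x := fun x => by rw [← mul_assoc, hβ', neg_one_mul]
  -- Since `(P β)² = 0` and `P β P γ = 0`, only the sandwich `P β (N f) P β` survives in the double
  -- commutator, and `P N P = -2 P`.
  have h₁ : (4 : ℂ) • (P * (j β * (j (τ f) * j β))) = 0 := by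
    rw [← sub_eq_zero] at hl
    rw [← hl]
    simp only [map_neg, mul_add, add_mul, mul_sub, sub_mul, neg_mul, mul_neg, mul_assoc,
      h.null_left', h.swap', h.comm_left, h.comm_left', h.comm_right', h.invol, hτ,
      smul_mul_assoc, mul_smul_comm, hβ', mul_one]
    module
  have h₂ := (smul_eq_zero.mp h₁).resolve_left (by norm_num)
  have h₃ : j β * (P * (j β * (j (τ f) * j β))) * j β = -(P * j (τ f)) := by
    rw [h.comm_left', hτ, map_neg, neg_mul, hβ'', neg_neg, mul_assoc, mul_assoc, hβ', mul_neg_one,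
      mul_neg]
  rw [h₂, mul_zero, zero_mul] at h₃
  exact neg_eq_zero.mp h₃.symm

/-- Multiplying by `P` on both sides isolates `f`; then `P` on the left isolates `d` and `P` on the
right isolates `c`. -/
theorem lightForm_eq_zero {c d e f : A} (hx : lightForm j P N c d e f = 0) :
    P * j (τ c) = 0 ∧ P * j d = 0 ∧ P * j e = 0 ∧ P * j (τ f) = 0 := by
  have hf : P * j (τ f) = 0 := by
    have h₁ : P * lightForm j P N c d e f * P = (-2 : ℂ) • (P * j (τ f)) := by
      simp only [lightForm, mul_add, add_mul, mul_assoc, smul_mul_assoc, mul_smul_comm,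
        h.null_left', h.comm_left, h.left_mul_right_mul_left', smul_zero, zero_add, zero_mul]
    rw [hx, mul_zero, zero_mul] at h₁
    exact (smul_eq_zero.mp h₁.symm).resolve_left (by norm_num)
  have hd : P * j d = 0 := by
    have h₁ : P * lightForm j P N c d e f = P * j d + P * (N * j f) := by
      simp only [lightForm, mul_add, mul_assoc, smul_mul_assoc, mul_smul_comm,
        h.null_left', h.left_mul_right_mul_left']
      module
    rw [hx, mul_zero, h.right_eq_zero hf, mul_zero, add_zero] at h₁
    exact h₁.symm
  have hc : P * j (τ c) = 0 := by
    have h₁ : lightForm j P N c d e f * P = P * j (τ c) + N * j f * P := by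
      simp only [lightForm, add_mul, mul_assoc, smul_mul_assoc, h.null_left', h.comm_left,
        h.left_mul_right_mul_left', mul_zero]
      module
    rw [hx, zero_mul, h.right_eq_zero hf, zero_mul, add_zero] at h₁
    exact h₁.symm
  refine ⟨hc, hd, ?_, hf⟩
  have hN : N * j c = j (τ c) * N := by rw [h.comm_right, h.invol]
  rw [lightForm, h.right_eq_zero hf, smul_mul_assoc, smul_mul_assoc, mul_assoc, mul_assoc, hd,
    hN, ← mul_assoc, hc] at hx
  simpa using hx

theorem lightForm_congr {c d c' d' : A} (hc : P * j (τ c) = P * j (τ c')) (hd : P * j d = P * j d')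
    (e f : A) : lightForm j P N c d e f = lightForm j P N c' d' e f := by
  have hN : ∀ x, P * N * j x = P * j (τ x) * N := fun x => by
    rw [mul_assoc, mul_assoc, h.comm_right, h.invol]
  simp only [lightForm, smul_mul_assoc, hN, hc, mul_assoc N, hd]

/-- The elements `a` with `P a = 0`. -/
def leftKernel : Ideal A where
  carrier := {a | P * j a = 0}
  add_mem' {a b} ha hb := by
    rw [Set.mem_ofPred_eq] at *
    rw [map_add, mul_add, ha, hb, add_zero]
  zero_mem' := by simp
  smul_mem' a b hb := by
    rw [Set.mem_ofPred_eq] at *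
    -- Moving `P` past `a` costs only `τ`, so the right annihilator of `P` is also a left ideal.
    have := h.comm_left' (τ a) (j b)
    rwa [hb, mul_zero, h.invol, ← map_mul, eq_comm] at this

theorem mem_leftKernel {a : A} : a ∈ h.leftKernel ↔ P * j a = 0 := Iff.rfl

theorem mul_mem_leftKernel (a : A) (ha : a ∈ h.leftKernel) (b : A) : a * b ∈ h.leftKernel := by
  rw [mem_leftKernel] at *
  rw [map_mul, ← mul_assoc, ha, zero_mul]

theorem one_notMem_leftKernel [Nontrivial Q] : (1 : A) ∉ h.leftKernel := by
  rw [mem_leftKernel, map_one, mul_one]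
  intro hP
  have h₁ := h.swap_smul
  rw [hP, mul_zero, zero_mul, sub_zero, eq_comm, smul_eq_zero] at h₁
  simp at h₁

omit h in
theorem lightForm_commute {z : Q} (hP : Commute z P) (hN : Commute z N)
    (hj : ∀ a, Commute z (j a)) (c d e f : A) : Commute z (lightForm j P N c d e f) :=
  ((((((hP.mul_right hN).smul_right _).mul_right (hj c)).add_right
    (((hN.mul_right hP).smul_right _).mul_right (hj d))).add_right (hP.mul_right (hj e)))).add_right
    (hN.mul_right (hj f))

section Volume

variable {w : A} (hw : w * w = 1) (hτ : τ w = -w) (hc : ∀ a, w * a = a * w)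

include hτ hc in
-- Here `1 + P * N` is `σ`, which anticommutes with `P` and `N`; so does the odd element `w`, and
-- the two signs cancel.
theorem volume_commute (c d e f : A) :
    Commute ((1 + P * N) * j w) (lightForm j P N c d e f) := by
  apply lightForm_commute
  · rw [commute_iff_eq]
    simp only [add_mul, mul_add, one_mul, mul_assoc, h.comm_left, hτ, map_neg,
      mul_neg, h.null_left', h.swap', mul_sub, mul_smul_comm]
    module
  · rw [commute_iff_eq]
    simp only [add_mul, mul_add, one_mul, mul_assoc, h.comm_right, hτ, map_neg,
      mul_neg, h.null_right', h.swap', mul_zero]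
    module
  · intro a
    rw [commute_iff_eq]
    simp only [add_mul, mul_add, one_mul, mul_assoc, h.comm_left', h.comm_right', h.invol,
      ← map_mul, hc]

include hw in
theorem volume_mul_volume : (1 + P * N) * j w * ((1 + P * N) * j w) = 1 := by
  have hw' : j w * j w = 1 := by rw [← map_mul, hw, map_one]
  simp only [add_mul, mul_add, one_mul, mul_assoc, h.comm_left', h.comm_right', h.invol, hw',
    h.swap', mul_sub, h.null_left', h.null_right, mul_one, mul_smul_comm]
  module

theorem left_mul_volume : P * ((1 + P * N) * j w) = P * j w := by
  rw [add_mul, one_mul, mul_add, mul_assoc P N, h.null_left', add_zero]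

include hτ in
/-- If the volume element acts as a scalar, every element is even modulo the kernel of `P`. -/
theorem exists_even {ε : ℂ} (hε : ε * ε = 1) (hPw : P * j w = ε • P) (a : A) :
    ∃ a', P * j a = P * j a' ∧ τ a' = a' := by
  -- The even part of `a` is kept and the odd part is multiplied by `ε w`, which makes it even; `P
  -- (ε w) = P` because `ε² = 1`.
  refine ⟨(1 / 2 : ℂ) • (a + τ a) + (ε / 2) • (w * (a - τ a)), ?_, ?_⟩
  · have hPw' : ∀ x, P * (j w * x) = ε • (P * x) := fun x => by
      rw [← mul_assoc, hPw, smul_mul_assoc]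
    simp only [map_add, map_smul, map_mul, map_sub, mul_add, mul_sub, mul_smul_comm, hPw']
    rw [← smul_sub, smul_smul, div_mul_eq_mul_div, hε]
    module
  · simp only [map_add, map_smul, map_mul, map_sub, h.invol, hτ, neg_mul, mul_sub]
    module

end Volume

end IsLightCone
end LightCone
end CW

namespace CW

/-! ### The complex Clifford algebras of `V` and `W` -/

section Clifford

variable {E : Type*} [AddCommGroup E] [Module ℝ E] (β : E →ₗ[ℝ] E →ₗ[ℝ] ℝ)

theorem cl_induction {p : Cl β → Prop} (hgam : ∀ x, p (gam β x))
    (hmap : ∀ r : ℂ, p (algebraMap ℂ (Cl β) r)) (hadd : ∀ x y, p x → p y → p (x + y))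
    (hmul : ∀ x y, p x → p y → p (x * y)) (a : Cl β) : p a := by
  induction a using TensorProduct.induction_on with
  | zero => simpa using hmap 0
  | add x y hx hy => exact hadd x y hx hy
  | tmul z x =>
    have h₁ : p (1 ⊗ₜ x) := by
      induction x using CliffordAlgebra.induction with
      | algebraMap r =>
        rw [Algebra.algebraMap_eq_smul_one, ← TensorProduct.smul_tmul]
        have := hmap (r • 1)
        rwa [Algebra.TensorProduct.algebraMap_apply] at this
      | ι x => exact hgam x
      | mul a b ha hb => simpa using hmul _ _ ha hb
      | add a b ha hb => rw [TensorProduct.tmul_add]; exact hadd _ _ ha hb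
    have h₂ := hmul _ _ (hmap z) h₁
    rwa [Algebra.TensorProduct.algebraMap_apply, Algebra.TensorProduct.tmul_mul_tmul, one_mul,
      mul_one] at h₂

theorem bar_gam (x : E) : bar β (gam β x) = -gam β x := by
  simp [bar, gam, TensorProduct.tmul_neg]

theorem bar_bar (a : Cl β) : bar β (bar β a) = a := by
  induction a using cl_induction with
  | hgam x => rw [bar_gam, map_neg, bar_gam, neg_neg]
  | hmap r => rw [AlgHom.commutes, AlgHom.commutes]
  | hadd x y hx hy => rw [map_add, map_add, hx, hy]
  | hmul x y hx hy => rw [map_mul, map_mul, hx, hy]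

theorem gam_mul_self (x : E) : gam β x * gam β x = (-β x x : ℝ) • (1 : Cl β) := by
  have h : cliffordForm β x = -β x x := rfl
  simp only [gam, LinearMap.comp_apply, TensorProduct.mk_apply,
    Algebra.TensorProduct.tmul_mul_tmul, CliffordAlgebra.ι_sq_scalar, mul_one, h,
    Algebra.algebraMap_eq_smul_one, TensorProduct.tmul_smul]
  rfl

theorem gam_anticomm_of_eq_zero (hβ : ∀ x y, β x y = β y x) {x y : E} (hxy : β x y = 0) :
    gam β x * gam β y = -(gam β y * gam β x) := by
  have := gam_anticomm β hβ x y
  rw [hxy, mul_zero, zero_smul] at this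
  exact eq_neg_of_add_eq_zero_left this

end Clifford

section Euclid

variable (V : Type*) [NormedAddCommGroup V] [InnerProductSpace ℝ V]

theorem isCliffordSystem {ι : Type*} [Fintype ι] (b : OrthonormalBasis ι ℝ V) :
    IsCliffordSystem (fun i => gam (innerₗ V) (b i)) (bar (innerₗ V)) where
  sq i := by rw [gam_mul_self]; simp
  anticomm i j hij := gam_anticomm_of_eq_zero _ (fun x y => by simp [real_inner_comm])
    (by simpa using b.orthonormal.2 hij)
  odd i := bar_gam _ _
  invol := bar_bar _
  adjoin := by
    rw [eq_top_iff]
    rintro a -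
    induction a using cl_induction with
    | hgam x =>
      rw [← b.sum_repr x, map_sum]
      refine sum_mem fun i _ => ?_
      rw [map_smul]
      have : (b.repr x i) • gam (innerₗ V) (b i) = ((b.repr x i : ℝ) : ℂ) • gam (innerₗ V) (b i) :=
        (RCLike.real_smul_eq_coe_smul (K := ℂ) _ _)
      rw [this]
      exact Subalgebra.smul_mem _ (Algebra.subset_adjoin (Set.mem_range_self i)) _
    | hmap r => exact Subalgebra.algebraMap_mem _ r
    | hadd x y hx hy => exact add_mem hx hy
    | hmul x y hx hy => exact mul_mem hx hy

variable {V}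

theorem lorentz_comm (x y : W V) : lorentz V x y = lorentz V y x := by
  simp [lorentz, real_inner_comm]
  ring

theorem incl_gam (v : V) : incl V (gam (innerₗ V) v) = gam (lorentz V) (v, 0, 0) := by
  simp only [incl, gam, LinearMap.comp_apply, TensorProduct.mk_apply,
    Algebra.TensorProduct.map_tmul, AlgHom.id_apply, CliffordAlgebra.map_apply_ι]
  rfl

theorem incl_mul_of_ortho {x : W V} (hx : ∀ v : V, lorentz V (v, 0, 0) x = 0) (a : ClV V) :
    incl V a * gam (lorentz V) x = gam (lorentz V) x * incl V (bar _ a) := by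
  induction a using cl_induction with
  | hgam v =>
    rw [incl_gam, bar_gam, map_neg, incl_gam, gam_anticomm_of_eq_zero _ lorentz_comm (hx v)]
    exact (mul_neg (gam (lorentz V) x) _).symm
  | hmap r => rw [AlgHom.commutes, AlgHom.commutes, AlgHom.commutes, Algebra.commutes]
  | hadd a b ha hb => simp only [map_add, add_mul, mul_add, ha, hb]
  | hmul a b ha hb => simp only [map_mul, mul_assoc, hb]; simp only [← mul_assoc, ha]

variable (V) in
theorem isLightCone : IsLightCone (bar (innerₗ V)) (incl V) (GammaP V) (GammaM V) where
  invol := bar_bar _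
  null_left := by 
    rw [GammaP, gam_mul_self, show lorentz V (ePlus V) (ePlus V) = 0 by simp [lorentz, ePlus],
      neg_zero]
    exact zero_smul ℝ _
  null_right := by 
    rw [GammaM, gam_mul_self, show lorentz V (eMinus V) (eMinus V) = 0 by simp [lorentz, eMinus],
      neg_zero]
    exact zero_smul ℝ _
  swap := by
    rw [eq_sub_iff_add_eq, GammaP, GammaM, gam_anticomm _ lorentz_comm]
    have h : (-2 * lorentz V (eMinus V) (ePlus V) : ℝ) = -2 := by simp [lorentz, ePlus, eMinus]
    rw [h, RCLike.real_smul_eq_coe_smul (K := ℂ)]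
    push_cast
    rw [neg_smul, two_smul, one_add_one_eq_two]
  comm_left := incl_mul_of_ortho fun v => by simp [lorentz, ePlus]
  comm_right := incl_mul_of_ortho fun v => by simp [lorentz, eMinus]

theorem sigma_eq : sigma V = 1 + GammaP V * GammaM V := by
  rw [sigma, (isLightCone V).swap_smul]
  module

theorem sigmaM_eq : sigmaM V = (-(1 / 2 : ℂ)) • (GammaP V * GammaM V) := by
  rw [sigmaM, sigma_eq]
  module

theorem sigmaP_eq : sigmaP V = (-(1 / 2 : ℂ)) • (GammaM V * GammaP V) := by
  rw [sigmaP, sigma_eq, (isLightCone V).swap_smul]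
  module

/-- Light forms are closed under products, so generators suffice; a vector of `V` takes `c = d`
because `σ₋ + σ₊ = 1`. -/
theorem exists_lightForm (x : ClW V) :
    ∃ c d e f, x = lightForm (incl V) (GammaP V) (GammaM V) c d e f := by
  have h := isLightCone V
  induction x using cl_induction with
  | hgam x =>
    refine ⟨gam _ x.1, gam _ x.1, algebraMap ℂ _ x.2.1, algebraMap ℂ _ x.2.2, ?_⟩
    have h₁ : gam (lorentz V) x = gam (lorentz V) (x.1, 0, 0)
        + (x.2.1 • GammaP V + x.2.2 • GammaM V) := by
      rw [GammaP, GammaM, ← map_smul, ← map_smul, ← map_add, ← map_add]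
      congr 1
      ext <;> simp [ePlus, eMinus]
    rw [h₁, RCLike.real_smul_eq_coe_smul (K := ℂ), RCLike.real_smul_eq_coe_smul (K := ℂ), lightForm,
      AlgHom.commutes, AlgHom.commutes, Algebra.algebraMap_eq_smul_one,
      Algebra.algebraMap_eq_smul_one, h.swap_smul, incl_gam]
    simp only [smul_mul_assoc, sub_mul, one_mul, mul_smul_comm, mul_one]
    module
  | hmap r => exact ⟨_, _, _, _, (h.lightForm_algebraMap r).symm⟩
  | hadd x y hx hy =>
    obtain ⟨c, d, e, f, rfl⟩ := hx
    obtain ⟨c', d', e', f', rfl⟩ := hy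
    refine ⟨c + c', d + d', e + e', f + f', ?_⟩
    simp only [lightForm, map_add, mul_add]
    abel
  | hmul x y hx hy =>
    obtain ⟨c, d, e, f, rfl⟩ := hx
    obtain ⟨c', d', e', f', rfl⟩ := hy
    exact ⟨_, _, _, _, h.lightForm_mul ..⟩

end Euclid
end CW

namespace CW

/-! ### Cancelling `Γ₊` in a quotient of `Cl(W)` -/

section Action

variable {V : Type*} [NormedAddCommGroup V] [InnerProductSpace ℝ V]
variable {Q : Type*} [Ring Q] [Algebra ℂ Q]

variable (V) in
/-- Every central involution is mapped to a sign. -/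
def CentralSigns (φ : ClW V →ₐ[ℂ] Q) : Prop :=
  ∀ z : ClW V, (∀ x, Commute z x) → z * z = 1 → φ z = 1 ∨ φ z = -1

theorem isLightCone_map (φ : ClW V →ₐ[ℂ] Q) :
    IsLightCone (bar (innerₗ V)) (φ.comp (incl V)) (φ (GammaP V)) (φ (GammaM V)) :=
  (isLightCone V).map φ

theorem map_lightForm (φ : ClW V →ₐ[ℂ] Q) (c d e f : ClV V) :
    φ (lightForm (incl V) (GammaP V) (GammaM V) c d e f) =
      lightForm (φ.comp (incl V)) (φ (GammaP V)) (φ (GammaM V)) c d e f := by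
  simp [lightForm]

variable [FiniteDimensional ℝ V]

/-- The central involution `σ w` acts by a sign `ε`, and `Γ₊ σ = Γ₊`, so `Γ₊ w` acts as `ε Γ₊`. -/
theorem exists_even_of_odd {φ : ClW V →ₐ[ℂ] Q} (hφ : CentralSigns V φ)
    (hV : Odd (Module.finrank ℝ V)) (a : ClV V) :
    ∃ a', φ (GammaP V) * φ (incl V a) = φ (GammaP V) * φ (incl V a') ∧ bar _ a' = a' := by
  obtain ⟨w, hw, hτ, hc⟩ :=
    (isCliffordSystem V (stdOrthonormalBasis ℝ V)).exists_volume_of_odd (by simpa using hV)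
  have h := isLightCone V
  have hz : ∀ x, Commute ((1 + GammaP V * GammaM V) * incl V w) x := fun x => by
    obtain ⟨c, d, e, f, rfl⟩ := exists_lightForm x
    exact h.volume_commute hτ hc c d e f
  have hPz := congrArg φ (h.left_mul_volume (w := w))
  rw [map_mul, map_mul _ (GammaP V) (incl V w)] at hPz
  rcases hφ _ hz (h.volume_mul_volume hw) with hs | hs
  · refine (isLightCone_map φ).exists_even hτ (ε := 1) (by norm_num) ?_ a
    rw [hs, mul_one] at hPz
    rw [one_smul]
    exact hPz.symm
  · refine (isLightCone_map φ).exists_even hτ (ε := -1) (by norm_num) ?_ a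
    rw [hs, mul_neg_one] at hPz
    rw [neg_one_smul]
    exact hPz.symm

theorem eq_zero_of_left_mul_of_even [Nontrivial Q] {φ : ClW V →ₐ[ℂ] Q}
    (hV : Even (Module.finrank ℝ V)) {a : ClV V} (ha : φ (GammaP V) * φ (incl V a) = 0) : a = 0 :=
  (isCliffordSystem V (stdOrthonormalBasis ℝ V)).eq_zero_of_mem_of_even (by simpa using hV)
    (isLightCone_map φ).leftKernel (isLightCone_map φ).mul_mem_leftKernel
    (isLightCone_map φ).one_notMem_leftKernel ha

theorem eq_zero_of_left_mul_of_map_eq_neg [Nontrivial Q] {φ : ClW V →ₐ[ℂ] Q} {a : ClV V}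
    (ha : φ (GammaP V) * φ (incl V a) = 0) (hτ : bar _ a = -a) : a = 0 :=
  (isCliffordSystem V (stdOrthonormalBasis ℝ V)).eq_zero_of_mem_of_map_mem
    (isLightCone_map φ).leftKernel (isLightCone_map φ).mul_mem_leftKernel
    (isLightCone_map φ).one_notMem_leftKernel ha (hτ ▸ neg_mem ha)

/-- In even dimension simplicity cancels `Γ₊` directly. In odd dimension `a'` and `b'` are chosen
even, so that the defect is odd and graded simplicity suffices. -/
theorem exists_reduction [Nontrivial Q] {φ : ClW V →ₐ[ℂ] Q} (hφ : CentralSigns V φ)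
    (a b : ClV V) : ∃ a' b', φ (GammaP V) * φ (incl V a) = φ (GammaP V) * φ (incl V a') ∧
      φ (GammaP V) * φ (incl V b) = φ (GammaP V) * φ (incl V b') ∧
      ∀ v u : V, φ (GammaP V) * φ (incl V (qMap a' b' (gam _ v) + gam _ u)) = 0 →
        qMap a' b' (gam _ v) + gam _ u = 0 := by
  rcases Nat.even_or_odd (Module.finrank ℝ V) with hV | hV
  · exact ⟨a, b, rfl, rfl, fun v u => eq_zero_of_left_mul_of_even hV⟩
  · obtain ⟨a', ha, hτa⟩ := exists_even_of_odd hφ hV a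
    obtain ⟨b', hb, hτb⟩ := exists_even_of_odd hφ hV b
    refine ⟨a', b', ha, hb, fun v u h => eq_zero_of_left_mul_of_map_eq_neg h ?_⟩
    exact map_qMap_add (τ := bar (innerₗ V)) hτa hτb (bar_gam _ v) (bar_gam _ u)

end Action

/-! ### Brackets of `𝔤` and null translations -/

namespace Datum

variable {V : Type*} [NormedAddCommGroup V] [InnerProductSpace ℝ V] (M : Datum V)

theorem star_lie_eM (v : V) : ⁅M.star v, M.eM⁆ = M.ofV (M.B v) := by
  apply M.alg_ext
  · simp [bracket_eq, star, eM, ofV, ofW, eMinus]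
  · simp [bracket_eq, star, eM, ofV, ofW, eMinus]

theorem star_lie_ofV (v w : V) : ⁅M.star v, M.ofV w⁆ = (-⟪M.B v, w⟫_ℝ) • M.eP := by
  apply M.alg_ext
  · simp [bracket_eq, star, eP, ofV, ofW, ePlus]
  · simp [bracket_eq, star, eP, ofV, ofW, ePlus]

theorem eM_lie_ofV (w : V) : ⁅M.eM, M.ofV w⁆ = M.star w := by
  apply M.alg_ext
  · simp [bracket_eq, star, eM, ofV, ofW, eMinus]
  · simp [bracket_eq, star, eM, ofV, ofW, eMinus]

theorem spin_eq (v : V) :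
    M.spin v = (1 / 2 : ℂ) • (GammaP V * incl V (gam _ (M.B v))) := by
  have h := (isLightCone V).comm_left (gam _ (M.B v))
  rw [bar_gam, map_neg, incl_gam] at h
  replace h := h.trans (mul_neg (GammaP V) _)
  rw [spin, spinWedge, incl_gam]
  change (1 / 4 : ℂ) • (GammaP V * _ - _ * GammaP V) = _
  rw [h]
  module

theorem eq_sum (x : M.Alg) : x = M.star (M.fstL x) + M.ofV (M.sndL x).1
    + (M.sndL x).2.1 • M.eP + (M.sndL x).2.2 • M.eM := by
  apply M.alg_ext
  · simp [star, eM, eP, ofV, ofW]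
  · ext <;> simp [star, eM, eP, ofV, ofW, ePlus, eMinus]

/-- The Clifford algebra element `B v - s_{a,b}(w)` attached to `v* + w + p e₊ + m e₋`. -/
def nullPart (a b : ClV V) : M.Alg →ₗ[ℝ] ClV V :=
  gam (innerₗ V) ∘ₗ M.B ∘ₗ M.fstL
    - (LinearMap.mulLeft ℝ a - LinearMap.mulRight ℝ b) ∘ₗ gam (innerₗ V)
      ∘ₗ LinearMap.fst ℝ V (ℝ × ℝ) ∘ₗ M.sndL

theorem nullPart_apply (a b : ClV V) (x : M.Alg) : M.nullPart a b x =
    gam _ (M.B (M.fstL x)) - sMap a b (gam _ (M.sndL x).1) := rfl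

/-- By `q = s ∘ s`, a pair representing `-B` turns the bracket with `e₋` into `x ↦ x b - a x`, up to
sign. -/
theorem nullPart_lie {a b : ClV V} (hab : ∀ v, qMap a b (gam _ v) = gam _ ((-M.B) v))
    (x y : M.Alg) : M.nullPart a b ⁅x, y⁆ =
      ((M.sndL y).2.2 : ℂ) • (M.nullPart a b x * b - a * M.nullPart a b x)
      - ((M.sndL x).2.2 : ℂ) • (M.nullPart a b y * b - a * M.nullPart a b y) := by
  have h : ∀ x : M.Alg, M.nullPart a b x * b - a * M.nullPart a b x =
      -sMap a b (gam _ (M.B (M.fstL x))) - gam _ (M.B (M.sndL x).1) := fun x => by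
    exact sMap_lie ((hab _).trans (map_neg _ _))
  rw [h, h, nullPart_apply, bracket_eq]
  simp only [fstL_elt, sndL_elt, map_sub, map_smul, RCLike.real_smul_eq_coe_smul (K := ℂ)]
  exact sub_sMap_smul (R := ClV V) a b _ _ _ _ _ _

end Datum
end CW

namespace CW

theorem IsAssociatedTo.of_eq {V : Type*} [NormedAddCommGroup V] [InnerProductSpace ℝ V]
    {a b : ClV V} {T : V →ₗ[ℝ] V} (hT : T.IsSymmetric)
    (h : ∀ v, qMap a b (gam (innerₗ V) v) = gam (innerₗ V) (T v)) : IsAssociatedTo a b T :=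
  ⟨⟨T, hT, h⟩, h⟩

namespace Datum

/-! ### Equivalence of the bracket relations with the formulas -/

section

variable {V : Type*} [NormedAddCommGroup V] [InnerProductSpace ℝ V] (M : Datum V)
variable {Q : Type*} [Ring Q] [Algebra ℂ Q] (φ : ClW V →ₐ[ℂ] Q)

theorem map_real_smul (ρ : M.Alg →ₗ[ℝ] ClW V) (r : ℝ) (x : M.Alg) :
    φ (ρ (r • x)) = (r : ℂ) • φ (ρ x) := by
  rw [map_smul, RCLike.real_smul_eq_coe_smul (K := ℂ), map_smul]
  rfl

/-- A map that is given by the formulas of the theorem, followed by `φ`, preserves brackets. -/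
theorem map_lie_of_formulas {ρ : M.Alg →ₗ[ℝ] ClW V} {c d e : ClV V}
    (hcd : IsAssociatedTo (bar _ c) d (-M.B)) (heP : φ (ρ M.eP) = 0)
    (hstar : ∀ v, φ (ρ (M.star v)) =
      φ ((1 / 2 : ℂ) • (GammaP V * incl V (gam _ (M.B v)))))
    (hofV : ∀ w, φ (ρ (M.ofV w)) =
      φ (-((1 / 2 : ℂ) • (GammaP V * incl V (sMap (bar _ c) d (gam _ w))))))
    (heM : φ (ρ M.eM) = φ (lightForm (incl V) (GammaP V) (GammaM V) c d e 0)) (x y : M.Alg) :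
    φ (ρ ⁅x, y⁆) = φ (ρ x * ρ y - ρ y * ρ x) := by
  have h := isLightCone_map φ
  set P := φ (GammaP V)
  set N := φ (GammaM V)
  set j := φ.comp (incl V)
  set α := M.nullPart (bar _ c) d
  have hρ : ∀ x, φ (ρ x) =
      (1 / 2 : ℂ) • (P * j (α x)) + ((M.sndL x).2.2 : ℂ) • lightForm j P N c d e 0 := fun x => by
    conv_lhs => rw [M.eq_sum x]
    rw [map_add, map_add, map_add, map_add, map_add, map_add, map_real_smul, map_real_smul, heP,
      hstar, hofV, heM, map_lightForm, map_neg, map_smul, map_smul, map_mul, map_mul, smul_zero,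
      add_zero, ← sub_eq_add_neg, ← smul_sub, ← mul_sub, ← map_sub, ← map_sub]
    rfl
  have hlie : ∀ x, P * j (α x) * lightForm j P N c d e 0 - lightForm j P N c d e 0 * (P * j (α x))
      = P * j (α x * d - bar _ c * α x) := fun x => h.lie_lightForm (α x) c d e
  have hm : (M.sndL ⁅x, y⁆).2.2 = 0 := by simp [bracket_eq]
  rw [map_sub, map_mul, map_mul, hρ, hρ, hρ, M.nullPart_lie hcd.2, hm, map_sub, map_smul, map_smul,
    mul_sub, mul_smul_comm, mul_smul_comm, ← hlie, ← hlie]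
  -- Null translations multiply to zero, so only the mixed commutators with the image of `e₋`
  -- remain.
  simp only [mul_add, add_mul, smul_mul_assoc, mul_smul_comm, h.lie_left_left]
  module

variable [FiniteDimensional ℝ V] [Nontrivial V]

/-- A representation with `ρ(e₊) = 0` is given by the formulas of the theorem. -/
theorem exists_formulas [Nontrivial Q] (hB : Function.Injective M.B) (hφ : CentralSigns V φ)
    {ρ : M.Alg →ₗ[ℝ] ClW V} (heP : φ (ρ M.eP) = 0)
    (hstar : ∀ v, φ (ρ (M.star v)) =
      φ ((1 / 2 : ℂ) • (GammaP V * incl V (gam _ (M.B v)))))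
    (hlie : ∀ x y, φ (ρ ⁅x, y⁆) = φ (ρ x * ρ y - ρ y * ρ x)) :
    ∃ c d e : ClV V, IsAssociatedTo (bar _ c) d (-M.B) ∧
      (∀ w, φ (ρ (M.ofV w)) =
        φ (-((1 / 2 : ℂ) • (GammaP V * incl V (sMap (bar _ c) d (gam _ w)))))) ∧
      φ (ρ M.eM) = φ (lightForm (incl V) (GammaP V) (GammaM V) c d e 0) := by
  have hsurj : Function.Surjective M.B := LinearMap.injective_iff_surjective.mp hB
  have h := isLightCone_map φ
  obtain ⟨c₀, d₀, e, f, hE⟩ := exists_lightForm (ρ M.eM)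
  replace hE := congrArg φ hE
  rw [map_lightForm] at hE
  simp only [map_lightForm, map_neg, map_smul, map_mul, map_sub] at hstar hlie ⊢
  simp only [← AlgHom.comp_apply φ] at hstar ⊢
  have hred := exists_reduction hφ (bar _ c₀) d₀
  simp only [← AlgHom.comp_apply φ] at hred
  generalize φ (GammaP V) = P at *
  generalize φ (GammaM V) = N at *
  generalize φ.comp (incl V) = j at *
  have hf : N * j f = 0 := by
    -- A unit vector makes `β² = -1`, so `β` can be cancelled later.
    obtain ⟨u, hu⟩ := exists_norm_eq V zero_le_one
    obtain ⟨v, rfl⟩ := hsurj u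
    set β := gam (innerₗ V) (M.B v) with hβ
    have hββ : β * β = -1 := by
      rw [hβ, gam_mul_self, innerₗ_apply_apply, real_inner_self_eq_norm_sq, hu]
      simp
    refine h.right_eq_zero_of_lie hββ (bar_gam _ _) (γ := β * d₀ - bar _ c₀ * β) ?_
    have h₁ := hlie (M.star v) M.eM
    have h₂ := hlie (M.star v) (M.ofV (M.B v))
    have h₃ : lightForm j P N c₀ d₀ e f = lightForm j P N c₀ d₀ e 0 + N * j f := by
      rw [lightForm, lightForm, map_zero, mul_zero, add_zero]
    have h₄ := h.lie_lightForm β c₀ d₀ e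
    rw [star_lie_eM, hstar, hE, h₃, ← hβ] at h₁
    rw [star_lie_ofV, map_real_smul, heP, smul_zero, h₁, hstar, ← hβ] at h₂
    rw [← h₄, ← sub_eq_zero]
    -- The factor 4 clears the two factors `1 / 2` contributed by the two occurrences of `ρ(v*)`.
    have h₅ := congrArg ((4 : ℂ) • ·) h₂.symm
    simp only [smul_zero] at h₅
    rw [← h₅]
    simp only [mul_add, add_mul, mul_sub, sub_mul, smul_mul_assoc, mul_smul_comm]
    module
  obtain ⟨a, d, ha, hd, had⟩ := hred
  -- Only `P (τ c)` and `P d` enter the operator, so the reduced pair may replace the original one.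
  rw [h.lightForm_congr (c' := bar _ a) (by rw [ha, bar_bar]) hd] at hE
  have hE' : φ (ρ M.eM) = lightForm j P N (bar _ a) d e 0 := by
    rw [hE, lightForm, lightForm, hf, map_zero, mul_zero]
  have hofV : ∀ w, φ (ρ (M.ofV w)) = -((1 / 2 : ℂ) • (P * j (sMap a d (gam _ w)))) := fun w => by
    obtain ⟨v, rfl⟩ := hsurj w
    have h₁ := h.lie_lightForm (gam _ (M.B v)) (bar _ a) d e
    rw [← star_lie_eM, hlie, hstar, hE', smul_mul_assoc, mul_smul_comm, ← smul_sub, h₁, bar_bar,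
      sMap, ← smul_neg, ← mul_neg, ← map_neg, neg_sub]
  refine ⟨bar _ a, d, e, ?_, ?_, hE'⟩
  · rw [bar_bar]
    refine IsAssociatedTo.of_eq (fun x y => by simp [M.symm x y]) fun w => ?_
    have h₁ := h.lie_lightForm (sMap a d (gam _ w)) (bar _ a) d e
    have h₂ := hlie M.eM (M.ofV w)
    rw [bar_bar, ← neg_sub (a * _), lie_sMap, map_neg, mul_neg] at h₁
    rw [eM_lie_ofV, hstar, hE', hofV] at h₂
    -- Comparing the two sides of `[e₋, w] = w*`; `had` then removes `P`.
    have h₃ : P * j (qMap a d (gam _ w) + gam _ (M.B w)) = 0 := by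
      simp only [mul_neg, neg_mul, smul_mul_assoc, mul_smul_comm] at h₂
      have h₄ := congrArg ((2 : ℂ) • ·) h₂
      simp only [smul_smul, one_div, mul_inv_cancel₀ (two_ne_zero (α := ℂ)), one_smul] at h₄
      rw [map_add, mul_add, ← neg_eq_iff_eq_neg.mpr h₁, h₄]
      module
    exact (eq_neg_of_add_eq_zero_left (had w (M.B w) h₃)).trans (map_neg _ _).symm
  · rw [bar_bar]
    exact hofV

end

end Datum
end CW

namespace CW

/-! ### Operators on an irreducible Clifford module -/

section Module

variable {V : Type*} [NormedAddCommGroup V] [InnerProductSpace ℝ V]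
variable (S : Type*) [AddCommGroup S] [Module (ClW V) S]

variable (V) in
/-- The algebra of operators on `S` that come from the Clifford algebra. -/
abbrev Operators : Type _ := ClW V ⧸ Module.annihilator (ClW V) S

variable (V) in
/-- The action of the Clifford algebra on `S`. -/
def action : ClW V →ₐ[ℂ] Operators V S :=
  Ideal.Quotient.mkₐ ℂ (Module.annihilator (ClW V) S)

variable {S}

theorem sameAction_iff {a b : ClW V} : SameAction S a b ↔ action V S a = action V S b := by
  rw [action, Ideal.Quotient.mkₐ_eq_mk, Ideal.Quotient.eq, Module.mem_annihilator]
  exact forall_congr' fun s => by rw [sub_smul, sub_eq_zero]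

variable [IsSimpleModule (ClW V) S]

variable (V S) in
theorem nontrivial_operators : Nontrivial (Operators V S) := by
  have := IsSimpleModule.nontrivial (ClW V) S
  obtain ⟨s, hs⟩ := exists_ne (0 : S)
  refine ⟨⟨action V S 1, action V S 0, fun h => hs ?_⟩⟩
  rw [← one_smul (ClW V) s, sameAction_iff.mpr h s]
  exact zero_smul (ClW V) s

/-- The fixed space of `z` is a submodule, hence everything or zero; in the latter case the fixed
vector `z s + s` vanishes. -/
theorem centralSigns_action : CentralSigns V (action V S) := by
  intro z hz hzz
  let K : Submodule (ClW V) S :=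
    { carrier := {s | z • s = s}
      add_mem' := fun {s t} hs ht => by
        rw [Set.mem_ofPred_eq] at *
        rw [smul_add, hs, ht]
      zero_mem' := smul_zero z
      smul_mem' := fun x s hs => by
        rw [Set.mem_ofPred_eq] at *
        rw [← mul_smul, (hz x).eq, mul_smul, hs] }
  have hK : ∀ s, s ∈ K ↔ z • s = s := fun s => Iff.rfl
  rcases eq_bot_or_eq_top K with h | h
  · right
    rw [← map_one (action V S), ← map_neg, ← sameAction_iff]
    intro s
    have h₁ : z • s + s ∈ K := by rw [hK, smul_add, ← mul_smul, hzz, one_smul, add_comm]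
    rw [h, Submodule.mem_bot] at h₁
    rw [neg_smul, one_smul]
    exact eq_neg_of_add_eq_zero_left h₁
  · left
    rw [← map_one (action V S), ← sameAction_iff]
    intro s
    have h₁ : s ∈ K := h ▸ Submodule.mem_top
    rw [one_smul]
    exact h₁

end Module

/-! ### Faithfulness in even dimension -/

section Even

variable {V : Type*} [NormedAddCommGroup V] [InnerProductSpace ℝ V] [FiniteDimensional ℝ V]
variable {Q : Type*} [Ring Q] [Algebra ℂ Q] [Nontrivial Q]

theorem lightForm_eq_zero_of_even {φ : ClW V →ₐ[ℂ] Q} (hV : Even (Module.finrank ℝ V))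
    {c d e f : ClV V} (hx : φ (lightForm (incl V) (GammaP V) (GammaM V) c d e f) = 0) :
    c = 0 ∧ d = 0 ∧ e = 0 ∧ f = 0 := by
  rw [map_lightForm] at hx
  obtain ⟨hc, hd, he, hf⟩ := (isLightCone_map φ).lightForm_eq_zero hx
  have h : ∀ a : ClV V, bar _ a = 0 → a = 0 := fun a ha => by rw [← bar_bar _ a, ha, map_zero]
  exact ⟨h _ (eq_zero_of_left_mul_of_even hV hc), eq_zero_of_left_mul_of_even hV hd,
    eq_zero_of_left_mul_of_even hV he, h _ (eq_zero_of_left_mul_of_even hV hf)⟩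

/-- In even dimension every nonzero representation of the Clifford algebra is faithful. -/
theorem injective_of_even (φ : ClW V →ₐ[ℂ] Q) (hV : Even (Module.finrank ℝ V)) :
    Function.Injective φ := by
  rw [injective_iff_map_eq_zero]
  intro x hx
  obtain ⟨c, d, e, f, rfl⟩ := exists_lightForm x
  obtain ⟨rfl, rfl, rfl, rfl⟩ := lightForm_eq_zero_of_even hV hx
  simp [lightForm]

end Even

/-! ### The representation defined by the formulas -/

section Formula

variable {V : Type*} [NormedAddCommGroup V] [InnerProductSpace ℝ V]

theorem lightForm_eq_sigma (c d e : ClV V) : lightForm (incl V) (GammaP V) (GammaM V) c d e 0 =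
    sigmaM V * incl V c + sigmaP V * incl V d + GammaP V * incl V e := by
  rw [lightForm, sigmaM_eq, sigmaP_eq, map_zero, mul_zero, add_zero]

namespace Datum

variable (M : Datum V)

/-- The linear map `𝔤 → Cl(W)` with the formulas of the theorem. -/
def formula (c d e : ClV V) : M.Alg →ₗ[ℝ] ClW V :=
  ((1 / 2 : ℂ) • LinearMap.mulLeft ℂ (GammaP V) ∘ₗ (incl V).toLinearMap).restrictScalars ℝ
      ∘ₗ M.nullPart (bar _ c) d
    + (LinearMap.toSpanSingleton ℝ (ClW V) (lightForm (incl V) (GammaP V) (GammaM V) c d e 0))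
      ∘ₗ LinearMap.snd ℝ ℝ ℝ ∘ₗ LinearMap.snd ℝ V (ℝ × ℝ) ∘ₗ M.sndL

theorem formula_apply (c d e : ClV V) (x : M.Alg) : M.formula c d e x =
    (1 / 2 : ℂ) • (GammaP V * incl V (M.nullPart (bar _ c) d x))
      + (M.sndL x).2.2 • lightForm (incl V) (GammaP V) (GammaM V) c d e 0 := rfl

variable (c d e : ClV V)

theorem formula_star (v : V) : M.formula c d e (M.star v) =
    (1 / 2 : ℂ) • (GammaP V * incl V (gam _ (M.B v))) := by
  simp [formula_apply, nullPart_apply, star, sMap]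

theorem formula_ofV (w : V) : M.formula c d e (M.ofV w) =
    -((1 / 2 : ℂ) • (GammaP V * incl V (sMap (bar _ c) d (gam _ w)))) := by
  have h : M.nullPart (bar _ c) d (M.ofV w) = -sMap (bar _ c) d (gam _ w) := by
    simp [nullPart_apply, ofV, ofW]
  have h₀ : (M.sndL (M.ofV w)).2.2 = 0 := rfl
  rw [formula_apply, h, h₀, zero_smul, add_zero, map_neg, ← smul_neg]
  exact congrArg _ (mul_neg (GammaP V) _)

theorem formula_eP : M.formula c d e M.eP = 0 := by
  simp [formula_apply, nullPart_apply, eP, ofW, ePlus, sMap]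

theorem formula_eM : M.formula c d e M.eM = lightForm (incl V) (GammaP V) (GammaM V) c d e 0 := by
  simp [formula_apply, nullPart_apply, eM, ofW, eMinus, sMap]

end Datum

variable {M : Datum V} {S : Type*} [AddCommGroup S] [Module (ClW V) S]

/-- A bracket-preserving map with the spin representation on `V*` is a Clifford representation. -/
theorem Datum.IsCliffordRep.of_action {ρ : M.Alg →ₗ[ℝ] ClW V}
    (hstar : ∀ v, action V S (ρ (M.star v)) =
      action V S ((1 / 2 : ℂ) • (GammaP V * incl V (gam _ (M.B v)))))
    (hlie : ∀ x y, action V S (ρ ⁅x, y⁆) = action V S (ρ x * ρ y - ρ y * ρ x)) :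
    M.IsCliffordRep S ρ where
  spin_rep v := by rw [sameAction_iff, hstar, M.spin_eq]
  -- Equivariance is the bracket relation with first argument `v*`.
  equivariant v x := by
    rw [sameAction_iff, hlie, M.spin_eq, map_sub, map_sub, map_mul, map_mul, map_mul, map_mul,
      hstar]
  map_lie x y := sameAction_iff.mpr (hlie x y)

end Formula

end CW

end

/-- Simple Clifford representations of the Cahen–Wallach space `M_B` on an irreducible Clifford
module `S`, with `ρ(e₊) = 0`. -/
theorem theorem3p1 {V : Type*} [NormedAddCommGroup V] [InnerProductSpace ℝ V]
    [FiniteDimensional ℝ V] [Nontrivial V] (M : CW.Datum V) (hB : Function.Injective M.B)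
    {S : Type*} [AddCommGroup S] [Module (CW.ClW V) S] [IsSimpleModule (CW.ClW V) S] :
    -- the representations with `ρ(e₊) = 0` are exactly the maps of the stated form on `S`
    (∀ ρ : M.Alg →ₗ[ℝ] CW.ClW V, CW.SameAction S (ρ M.eP) 0 →
      (M.IsCliffordRep S ρ ↔
        ∃ c d e : CW.ClV V,
          CW.IsAssociatedTo (CW.bar _ c) d (-M.B) ∧
          (∀ v : V, CW.SameAction S (ρ (M.star v))
            ((1 / 2 : ℂ) • (CW.GammaP V * CW.incl V (CW.gam _ (M.B v))))) ∧
          (∀ w : V, CW.SameAction S (ρ (M.ofV w))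
            (-((1 / 2 : ℂ) •
              (CW.GammaP V * CW.incl V (CW.sMap (CW.bar _ c) d (CW.gam _ w)))))) ∧
          CW.SameAction S (ρ M.eM)
            (CW.sigmaM V * CW.incl V c + CW.sigmaP V * CW.incl V d
              + CW.GammaP V * CW.incl V e))) ∧
    -- every quadratic Clifford pair representing `-B` occurs, with `e` free
    (∀ c d e : CW.ClV V, CW.IsAssociatedTo (CW.bar _ c) d (-M.B) →
      ∃ ρ : M.Alg →ₗ[ℝ] CW.ClW V, M.IsCliffordRep S ρ ∧ ρ M.eP = 0 ∧
        (∀ v : V, ρ (M.star v)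
          = (1 / 2 : ℂ) • (CW.GammaP V * CW.incl V (CW.gam _ (M.B v)))) ∧
        (∀ w : V, ρ (M.ofV w) = -((1 / 2 : ℂ) •
          (CW.GammaP V * CW.incl V (CW.sMap (CW.bar _ c) d (CW.gam _ w))))) ∧
        ρ M.eM = CW.sigmaM V * CW.incl V c + CW.sigmaP V * CW.incl V d
          + CW.GammaP V * CW.incl V e) ∧
    -- in even dimension the formulas hold in `Cl(W)` itself, with unique `c`, `d`, `e`
    (Even (Module.finrank ℝ V) → ∀ ρ : M.Alg →ₗ[ℝ] CW.ClW V,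
      M.IsCliffordRep S ρ → ρ M.eP = 0 →
        ∃! t : CW.ClV V × CW.ClV V × CW.ClV V,
          CW.IsAssociatedTo (CW.bar _ t.1) t.2.1 (-M.B) ∧
          (∀ v : V, ρ (M.star v)
            = (1 / 2 : ℂ) • (CW.GammaP V * CW.incl V (CW.gam _ (M.B v)))) ∧
          (∀ w : V, ρ (M.ofV w) = -((1 / 2 : ℂ) •
            (CW.GammaP V * CW.incl V (CW.sMap (CW.bar _ t.1) t.2.1 (CW.gam _ w))))) ∧
          ρ M.eM = CW.sigmaM V * CW.incl V t.1 + CW.sigmaP V * CW.incl V t.2.1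
            + CW.GammaP V * CW.incl V t.2.2) := by
  have := CW.nontrivial_operators V S
  have hiff : ∀ ρ : M.Alg →ₗ[ℝ] CW.ClW V, CW.SameAction S (ρ M.eP) 0 → M.IsCliffordRep S ρ →
      ∃ c d e : CW.ClV V, CW.IsAssociatedTo (CW.bar _ c) d (-M.B) ∧
        (∀ v : V, CW.SameAction S (ρ (M.star v))
          ((1 / 2 : ℂ) • (CW.GammaP V * CW.incl V (CW.gam _ (M.B v))))) ∧
        (∀ w : V, CW.SameAction S (ρ (M.ofV w))
          (-((1 / 2 : ℂ) •
            (CW.GammaP V * CW.incl V (CW.sMap (CW.bar _ c) d (CW.gam _ w)))))) ∧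
        CW.SameAction S (ρ M.eM)
          (CW.sigmaM V * CW.incl V c + CW.sigmaP V * CW.incl V d
            + CW.GammaP V * CW.incl V e) := by
    intro ρ heP hρ
    simp only [CW.sameAction_iff, ← CW.lightForm_eq_sigma] at heP ⊢
    rw [map_zero] at heP
    have hstar := fun v => CW.sameAction_iff.mp (M.spin_eq v ▸ hρ.spin_rep v)
    obtain ⟨c, d, e, h⟩ := M.exists_formulas _ hB CW.centralSigns_action heP hstar
      fun x y => CW.sameAction_iff.mp (hρ.map_lie x y)
    exact ⟨c, d, e, h.1, hstar, h.2⟩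
  refine ⟨fun ρ heP => ⟨hiff ρ heP, ?_⟩, fun c d e hcd => ?_, fun hV ρ hρ heP => ?_⟩
  · rintro ⟨c, d, e, hcd, hstar, hofV, heM⟩
    simp only [CW.sameAction_iff, ← CW.lightForm_eq_sigma] at heP hstar hofV heM
    rw [map_zero] at heP
    exact .of_action hstar (M.map_lie_of_formulas _ hcd heP hstar hofV heM)
  · refine ⟨M.formula c d e, .of_action (fun v => by rw [M.formula_star])
      (M.map_lie_of_formulas _ hcd (by rw [M.formula_eP, map_zero])
        (fun v => by rw [M.formula_star]) (fun w => by rw [M.formula_ofV])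
        (by rw [M.formula_eM])),
      M.formula_eP c d e, M.formula_star c d e, M.formula_ofV c d e, ?_⟩
    rw [M.formula_eM, CW.lightForm_eq_sigma]
  · have hinj := CW.injective_of_even (CW.action V S) hV
    have hS : ∀ {a b : CW.ClW V}, CW.SameAction S a b → a = b :=
      fun h => hinj (CW.sameAction_iff.mp h)
    obtain ⟨c, d, e, hcd, hstar, hofV, heM⟩ := hiff ρ (fun s => by rw [heP]) hρ
    refine ⟨(c, d, e), ⟨hcd, fun v => hS (hstar v), fun w => hS (hofV w), hS heM⟩, ?_⟩
    rintro ⟨c', d', e'⟩ ⟨-, -, -, heM'⟩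
    -- The value at `e₋` alone determines the triple: the difference of two expressions for it is a
    -- vanishing light form.
    have h : CW.lightForm (CW.incl V) (CW.GammaP V) (CW.GammaM V) (c' - c) (d' - d) (e' - e) 0
        = 0 := by
      have h₁ := heM'.symm.trans (hS heM)
      rw [← CW.lightForm_eq_sigma, ← CW.lightForm_eq_sigma, ← sub_eq_zero] at h₁
      rw [← h₁]
      simp only [CW.lightForm, map_sub, mul_sub, map_zero, mul_zero, add_zero]
      abel
    obtain ⟨hc, hd, he, -⟩ := CW.lightForm_eq_zero_of_even (φ := CW.action V S) hV
      (by rw [h, map_zero])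
    rw [sub_eq_zero.mp hc, sub_eq_zero.mp hd, sub_eq_zero.mp he]
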